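/- Fix the unary operators $\{\neg,\mathbf{X},\mathbf{F},\mathbf{G}\}$, the binary temporal operators $\{\mathbf{U},\mathbf{R},\mathbf{W},\mathbf{M}\}$ and the ten binary logical operators $\lor,\land,\Rightarrow,\Leftarrow,\Leftrightarrow$ and their negations. Let $U^t$, $B^t$, $B^l$ be arbitrary subsets of these three sets, and let $n\in\mathbb{N}\cup\{\infty\}$. For a logic $L$ among $\mathrm{LTL}$, $\mathrm{CTL}$, $\mathrm{ATL}^k$ ($k\ge 1$ agents), the decision problem $L_{\mathrm{Learn}}(U^t,B^t,B^l,n)$ is the following. The input is $(\mathrm{Prop},\mathcal{P},\mathcal{N},B)$, where $\mathrm{Prop}$ is a finite non-empty set of propositions, $\mathcal{P},\mathcal{N}$ are finite sets of models of $L$ over $\mathrm{Prop}$, and $B\in\mathbb{N}$ is written in unary. The models are ultimately periodic words $u\cdot v^\omega$ over $2^{\mathrm{Prop}}$, presented by $u$ and $v\neq\varepsilon$, for $\mathrm{LTL}$; finite Kripke structures (with a set of initial states and at least one successor for each state) for $\mathrm{CTL}$; and finite concurrent game structures with $k$ agents and a set of initial states for $\mathrm{ATL}^k$. A structure satisfies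 a formula when all its initial states do. The question is whether there is an $L$-formula $\varphi$ over $\mathrm{Prop}$ which uses only operators in $U^t\cup B^t\cup B^l$ (in $\mathrm{CTL}$, each temporal operator is immediately preceded by a path quantifier $\exists$ or $\forall$; in $\mathrm{ATL}^k$, by a strategic quantifier $\langle\!\langle A\rangle\!\rangle$ for a set $A$ of agents), which has at most $B$ distinct sub-formulas, at most $n$ of which have a binary main operator, and which is satisfied by all models in $\mathcal{P}$ and by no model in $\mathcal{N}$. Then $\mathrm{CTL}_{\mathrm{Learn}}(U^t,B^t,B^l,n)$ is at least as hard as $\mathrm{LTL}_{\mathrm{Learn}}(U^t,B^t,B^l,n)$ under logarithmic-space many-one reductions. More precisely, the map that keeps $\mathrm{Prop}$ and $B$ and replaces each word $w=u\cdot v^\omega$ in $\mathcal{P}$ and $\mathcal{N}$ by the lasso-shaped Kripke structure $K_w$ is such a reduction; here $K_w$ has one state for each position of $u\cdot v$, labelled by the letter at this position, its only initial state is the first one, each state but the last has the next one as its only successor, and the last state has the state of the first letter of $v$ as its only successor. Moreover, for every $k\ge 1$, $\mathrm{ATL}^k_{\mathrm{Learn}}(U^t,B^t,B^l,n)$ is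 at least as hard as $\mathrm{LTL}_{\mathrm{Learn}}(U^t,B^t,B^l,n)$ under logarithmic-space many-one reductions. -/

import Mathlib

namespace LearnTL

/-! ### Operators -/

/-- Unary temporal operators `X`, `F`, `G`. -/
inductive TempUn
  | X | F | G
  deriving DecidableEq

/-- All unary operators: negation and the unary temporal operators. -/
inductive UnOp
  | neg
  | temp (t : TempUn)
  deriving DecidableEq

/-- Binary temporal operators: until, release, weak until, mighty release. -/
inductive TempBin
  | U | R | W | M
  deriving DecidableEq

/-- Binary logical operators and their negations. -/
inductive LogBin
  | or | and | imp | revImp | iff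
  | nor | nand | nimp | nrevImp | niff
  deriving DecidableEq

/-- Truth of `t φ` along a sequence, where `P i` is the truth of `φ` on its `i`-th suffix. -/
def TempUn.Holds : TempUn → (ℕ → Prop) → Prop
  | .X, P => P 1
  | .F, P => ∃ i, P i
  | .G, P => ∀ i, P i

/-- Truth of `φ₁ U φ₂` along a sequence. -/
def UntilHolds (P Q : ℕ → Prop) : Prop := ∃ i, Q i ∧ ∀ j < i, P j

/-- Truth of `φ₁ t φ₂` along a sequence. -/
def TempBin.Holds : TempBin → (ℕ → Prop) → (ℕ → Prop) → Prop
  | .U, P, Q => UntilHolds P Q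
  | .R, P, Q => ¬ UntilHolds (fun i => ¬ P i) (fun i => ¬ Q i)
  | .W, P, Q => UntilHolds P Q ∨ ∀ i, P i
  | .M, P, Q => ¬ UntilHolds (fun i => ¬ P i) (fun i => ¬ Q i) ∧ ∃ i, P i

def LogBin.Holds : LogBin → Prop → Prop → Prop
  | .or, a, b => a ∨ b
  | .and, a, b => a ∧ b
  | .imp, a, b => a → b
  | .revImp, a, b => b → a
  | .iff, a, b => a ↔ b
  | .nor, a, b => ¬ (a ∨ b)
  | .nand, a, b => ¬ (a ∧ b)
  | .nimp, a, b => ¬ (a → b)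
  | .nrevImp, a, b => ¬ (b → a)
  | .niff, a, b => ¬ (a ↔ b)

/-! ### LTL. The set of propositions is `Fin p`. -/

inductive LTL (p : ℕ)
  | atom (x : Fin p)
  | neg (φ : LTL p)
  | tempUn (t : TempUn) (φ : LTL p)
  | tempBin (t : TempBin) (φ ψ : LTL p)
  | logBin (b : LogBin) (φ ψ : LTL p)
  deriving DecidableEq

namespace LTL

variable {p : ℕ}

/-- The formula only uses operators among the allowed ones. -/
def InFragment (Ut : Set UnOp) (Bt : Set TempBin) (Bl : Set LogBin) : LTL p → Prop
  | atom _ => True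
  | neg φ => UnOp.neg ∈ Ut ∧ InFragment Ut Bt Bl φ
  | tempUn t φ => UnOp.temp t ∈ Ut ∧ InFragment Ut Bt Bl φ
  | tempBin t φ ψ => t ∈ Bt ∧ InFragment Ut Bt Bl φ ∧ InFragment Ut Bt Bl ψ
  | logBin b φ ψ => b ∈ Bl ∧ InFragment Ut Bt Bl φ ∧ InFragment Ut Bt Bl ψ

def subF : LTL p → Finset (LTL p)
  | atom x => {atom x}
  | neg φ => insert (neg φ) (subF φ)
  | tempUn t φ => insert (tempUn t φ) (subF φ)
  | tempBin t φ ψ => insert (tempBin t φ ψ) (subF φ ∪ subF ψ)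
  | logBin b φ ψ => insert (logBin b φ ψ) (subF φ ∪ subF ψ)

/-- The main operator is binary. -/
def isBin : LTL p → Bool
  | tempBin _ _ _ => true
  | logBin _ _ _ => true
  | _ => false

/-- Number of distinct sub-formulas. -/
def size (φ : LTL p) : ℕ := φ.subF.card

/-- Number of distinct sub-formulas whose main operator is binary. -/
def nbBin (φ : LTL p) : ℕ := (φ.subF.filter fun ψ => ψ.isBin = true).card

/-- `w ⊨ φ` for an infinite word `w`. -/
def Sat : (ℕ → Finset (Fin p)) → LTL p → Prop
  | w, atom x => x ∈ w 0
  | w, neg φ => ¬ Sat w φ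
  | w, tempUn t φ => t.Holds fun i => Sat (fun j => w (i + j)) φ
  | w, tempBin t φ ψ =>
      t.Holds (fun i => Sat (fun j => w (i + j)) φ) (fun i => Sat (fun j => w (i + j)) ψ)
  | w, logBin b φ ψ => b.Holds (Sat w φ) (Sat w ψ)

end LTL

/-- An ultimately periodic word, presented by `u` and `v` (standing for `u · v^ω`). -/
structure UPWord (p : ℕ) where
  u : List (Finset (Fin p))
  v : List (Finset (Fin p))
  v_ne_nil : v ≠ []

/-- The infinite word `u · v^ω`. -/
def UPWord.toSeq {p : ℕ} (w : UPWord p) (i : ℕ) : Finset (Fin p) :=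
  if i < w.u.length then w.u.getD i ∅ else w.v.getD ((i - w.u.length) % w.v.length) ∅

/-! ### Branching-time state formulas

`Qt` is the type of the quantifiers put in front of path formulas: `∃`, `∀` for CTL,
coalitions of agents for ATL. -/

inductive BForm (p : ℕ) (Qt : Type)
  | atom (x : Fin p)
  | neg (φ : BForm p Qt)
  | tempUn (A : Qt) (t : TempUn) (φ : BForm p Qt)
  | tempBin (A : Qt) (t : TempBin) (φ ψ : BForm p Qt)
  | logBin (b : LogBin) (φ ψ : BForm p Qt)
  deriving DecidableEq

namespace BForm

variable {p : ℕ} {Qt : Type}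

def InFragment (Ut : Set UnOp) (Bt : Set TempBin) (Bl : Set LogBin) : BForm p Qt → Prop
  | atom _ => True
  | neg φ => UnOp.neg ∈ Ut ∧ InFragment Ut Bt Bl φ
  | tempUn _ t φ => UnOp.temp t ∈ Ut ∧ InFragment Ut Bt Bl φ
  | tempBin _ t φ ψ => t ∈ Bt ∧ InFragment Ut Bt Bl φ ∧ InFragment Ut Bt Bl ψ
  | logBin b φ ψ => b ∈ Bl ∧ InFragment Ut Bt Bl φ ∧ InFragment Ut Bt Bl ψ

def subF [DecidableEq Qt] : BForm p Qt → Finset (BForm p Qt)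
  | atom x => {atom x}
  | neg φ => insert (neg φ) (subF φ)
  | tempUn A t φ => insert (tempUn A t φ) (subF φ)
  | tempBin A t φ ψ => insert (tempBin A t φ ψ) (subF φ ∪ subF ψ)
  | logBin b φ ψ => insert (logBin b φ ψ) (subF φ ∪ subF ψ)

def isBin : BForm p Qt → Bool
  | tempBin _ _ _ _ => true
  | logBin _ _ _ => true
  | _ => false

def size [DecidableEq Qt] (φ : BForm p Qt) : ℕ := φ.subF.card

def nbBin [DecidableEq Qt] (φ : BForm p Qt) : ℕ :=
  (φ.subF.filter fun ψ => ψ.isBin = true).card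

/-- Satisfaction at a state. `quant A q T` says that, from the state `q`, the quantifier `A`
makes the set `T` of infinite state sequences hold. -/
def Sat {Q : Type} (label : Q → Finset (Fin p)) (quant : Qt → Q → Set (ℕ → Q) → Prop) :
    BForm p Qt → Q → Prop
  | atom x, q => x ∈ label q
  | neg φ, q => ¬ Sat label quant φ q
  | tempUn A t φ, q => quant A q {ρ | t.Holds fun i => Sat label quant φ (ρ i)}
  | tempBin A t φ ψ, q => quant A q
      {ρ | t.Holds (fun i => Sat label quant φ (ρ i)) (fun i => Sat label quant ψ (ρ i))}
  | logBin b φ ψ, q => b.Holds (Sat label quant φ q) (Sat label quant ψ q)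

end BForm

/-! ### Kripke structures and CTL -/

structure Kripke (p : ℕ) where
  numStates : ℕ
  init : Finset (Fin numStates)
  label : Fin numStates → Finset (Fin p)
  succ : Fin numStates → Finset (Fin numStates)
  succ_nonempty : ∀ q, (succ q).Nonempty

inductive PathQuant
  | all | ex
  deriving DecidableEq

abbrev CTL (p : ℕ) := BForm p PathQuant

namespace Kripke

variable {p : ℕ}

/-- Infinite paths from `q`. -/
def Out (K : Kripke p) (q : Fin K.numStates) : Set (ℕ → Fin K.numStates) :=
  {ρ | ρ 0 = q ∧ ∀ i, ρ (i + 1) ∈ K.succ (ρ i)}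

def Quant (K : Kripke p) :
    PathQuant → Fin K.numStates → Set (ℕ → Fin K.numStates) → Prop
  | .all, q, T => ∀ ρ ∈ K.Out q, ρ ∈ T
  | .ex, q, T => ∃ ρ ∈ K.Out q, ρ ∈ T

/-- `K ⊨ φ`: all initial states satisfy `φ`. -/
def Models (K : Kripke p) (φ : CTL p) : Prop :=
  ∀ q ∈ K.init, φ.Sat K.label K.Quant q

end Kripke

/-! ### Concurrent game structures and ATL -/

/-- Concurrent game structures with agents `Fin k`; at state `q`, agent `a` chooses an action in
`Fin (d q a)`. -/
structure CGS (k p : ℕ) where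
  numStates : ℕ
  init : Finset (Fin numStates)
  label : Fin numStates → Finset (Fin p)
  d : Fin numStates → Fin k → ℕ
  d_pos : ∀ q a, 0 < d q a
  δ : (q : Fin numStates) → ((a : Fin k) → Fin (d q a)) → Fin numStates

abbrev ATL (k p : ℕ) := BForm p (Finset (Fin k))

namespace CGS

variable {k p : ℕ}

/-- A strategy of agent `a`: a non-empty history is given as its past followed by its last
(current) state, and is mapped to an action available to `a` at the current state. -/
def Strategy (C : CGS k p) (a : Fin k) : Type :=
  List (Fin C.numStates) → (q : Fin C.numStates) → Fin (C.d q a)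

/-- One strategy for each agent of the coalition `A`. -/
def Profile (C : CGS k p) (A : Finset (Fin k)) : Type :=
  (a : Fin k) → a ∈ A → C.Strategy a

/-- Successors of `q` when the agents of `A` play `α`. -/
def Succ (C : CGS k p) (A : Finset (Fin k)) (q : Fin C.numStates)
    (α : (a : Fin k) → a ∈ A → Fin (C.d q a)) : Set (Fin C.numStates) :=
  {q' | ∃ β : (a : Fin k) → Fin (C.d q a), (∀ a (h : a ∈ A), β a = α a h) ∧ C.δ q β = q'}

/-- Infinite paths from `q` compatible with the strategy profile `s`. -/
def Out (C : CGS k p) {A : Finset (Fin k)} (q : Fin C.numStates) (s : C.Profile A) :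
    Set (ℕ → Fin C.numStates) :=
  {ρ | ρ 0 = q ∧
    ∀ i, ρ (i + 1) ∈ C.Succ A (ρ i) fun a h => s a h ((List.range i).map ρ) (ρ i)}

def Quant (C : CGS k p) (A : Finset (Fin k)) (q : Fin C.numStates)
    (T : Set (ℕ → Fin C.numStates)) : Prop :=
  ∃ s : C.Profile A, ∀ ρ ∈ C.Out q s, ρ ∈ T

def Models (C : CGS k p) (φ : ATL k p) : Prop :=
  ∀ q ∈ C.init, φ.Sat C.label C.Quant q

end CGS

/-! ### Self-delimiting binary encodings -/

def encBool (b : Bool) : List Bool := [b]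

/-- Unary encoding `1ⁿ0`. -/
def encUnary (n : ℕ) : List Bool := List.replicate n true ++ [false]

/-- A list is encoded by writing `1` in front of each entry and `0` after the last one. -/
def encList {α : Type} (e : α → List Bool) : List α → List Bool
  | [] => [false]
  | a :: l => true :: (e a ++ encList e l)

/-- Binary encoding, least significant digit first. -/
def encBinary (n : ℕ) : List Bool := encList encBool n.bits

/-- A set of propositions is encoded by its characteristic bit vector. -/
def encLabel {p : ℕ} (a : Finset (Fin p)) : List Bool :=
  encList encBool (List.ofFn fun i : Fin p => decide (i ∈ a))

def UPWord.enc {p : ℕ} (w : UPWord p) : List Bool :=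
  encList encLabel w.u ++ encList encLabel w.v

/-- One row per state: whether it is initial, its label, the list of its successors. -/
def Kripke.table {p : ℕ} (K : Kripke p) : List (Bool × Finset (Fin p) × List ℕ) :=
  List.ofFn fun q => (decide (q ∈ K.init), K.label q,
    ((List.finRange K.numStates).filter fun q' => q' ∈ K.succ q).map Fin.val)

def Kripke.enc {p : ℕ} (K : Kripke p) : List Bool :=
  encList (fun r => encBool r.1 ++ (encLabel r.2.1 ++ encList encBinary r.2.2)) K.table

/-- One row per state: whether it is initial, its label, the number of actions of each agent,
and the list of the successors by all the action tuples, in (mixed radix) order. -/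
def CGS.table {k p : ℕ} (C : CGS k p) : List (Bool × Finset (Fin p) × List ℕ × List ℕ) :=
  List.ofFn fun q => (decide (q ∈ C.init), C.label q, List.ofFn (C.d q),
    List.ofFn fun j => (C.δ q (finPiFinEquiv.symm j)).val)

def CGS.enc {k p : ℕ} (C : CGS k p) : List Bool :=
  encList (fun r => encBool r.1 ++ (encLabel r.2.1 ++
    (encList encUnary r.2.2.1 ++ encList encBinary r.2.2.2))) C.table

/-! Unique decodability of these encodings. -/

/-- `e` is injective and no code word is a proper prefix of another one. -/
def SelfDelim {α : Type} (e : α → List Bool) : Prop :=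
  ∀ a b r s, e a ++ r = e b ++ s → a = b ∧ r = s

theorem SelfDelim.injective {α : Type} {e : α → List Bool} (h : SelfDelim e) :
    Function.Injective e := fun a b hab => (h a b [] [] (by rw [hab])).1

theorem SelfDelim.comp {α β : Type} {e : β → List Bool} (h : SelfDelim e) {g : α → β}
    (hg : Function.Injective g) : SelfDelim fun a => e (g a) := fun _ _ _ _ hab =>
  ⟨hg (h _ _ _ _ hab).1, (h _ _ _ _ hab).2⟩

theorem SelfDelim.prod {α β : Type} {e : α → List Bool} {f : β → List Bool} (he : SelfDelim e)
    (hf : SelfDelim f) : SelfDelim fun x : α × β => e x.1 ++ f x.2 := by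
  rintro ⟨a, b⟩ ⟨a', b'⟩ r s h
  simp only [List.append_assoc] at h
  obtain ⟨rfl, h₁⟩ := he _ _ _ _ h
  obtain ⟨rfl, h₂⟩ := hf _ _ _ _ h₁
  exact ⟨rfl, h₂⟩

theorem selfDelim_encBool : SelfDelim encBool := by
  intro a b r s h
  simpa [encBool] using h

theorem selfDelim_encList {α : Type} {e : α → List Bool} (he : SelfDelim e) :
    SelfDelim (encList e) := by
  intro a
  induction a with
  | nil => intro b r s h; cases b <;> simp_all [encList]
  | cons x a ih =>
    intro b r s h
    cases b with
    | nil => simp [encList] at h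
    | cons y b =>
      simp only [encList, List.cons_append, List.append_assoc, List.cons.injEq, true_and] at h
      obtain ⟨rfl, h₁⟩ := he _ _ _ _ h
      obtain ⟨rfl, h₂⟩ := ih _ _ _ h₁
      exact ⟨rfl, h₂⟩

theorem selfDelim_encUnary : SelfDelim encUnary := by
  intro a
  induction a with
  | zero => intro b r s h; cases b <;> simp_all [encUnary, List.replicate_succ]
  | succ a ih =>
    intro b r s h
    cases b with
    | zero => simp [encUnary, List.replicate_succ] at h
    | succ b =>
      obtain ⟨rfl, h₁⟩ := ih b r s (by simpa [encUnary, List.replicate_succ] using h)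
      exact ⟨rfl, h₁⟩

theorem selfDelim_encBinary : SelfDelim encBinary :=
  (selfDelim_encList selfDelim_encBool).comp fun a b h =>
    Nat.digits_inj_iff.1 (by rw [Nat.digits_two_eq_bits, Nat.digits_two_eq_bits, h] :
      Nat.digits 2 a = Nat.digits 2 b)

theorem selfDelim_encLabel {p : ℕ} : SelfDelim (encLabel (p := p)) :=
  (selfDelim_encList selfDelim_encBool).comp fun a b h => by
    ext i
    have := congrFun (List.ofFn_injective h) i
    simpa using this

theorem UPWord.selfDelim_enc {p : ℕ} : SelfDelim (UPWord.enc (p := p)) :=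
  ((selfDelim_encList selfDelim_encLabel).prod (selfDelim_encList selfDelim_encLabel)).comp
    (g := fun w : UPWord p => (w.u, w.v)) fun a b h => by
      cases a; cases b; simp_all

theorem Kripke.table_injective {p : ℕ} : Function.Injective (Kripke.table (p := p)) := by
  rintro ⟨n, i, l, s, hs⟩ ⟨n', i', l', s', hs'⟩ h
  obtain rfl : n = n' := by simpa [Kripke.table] using congrArg List.length h
  have h := fun q => congrFun (List.ofFn_injective h) q
  simp only [Prod.mk.injEq, decide_eq_decide] at h
  obtain rfl : i = i' := Finset.ext fun q => (h q).1
  obtain rfl : l = l' := funext fun q => (h q).2.1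
  obtain rfl : s = s' := by
    funext q
    ext x
    have := congrArg (fun L => x ∈ L) (List.map_injective_iff.2 Fin.val_injective (h q).2.2)
    simpa using this
  rfl

theorem Kripke.selfDelim_enc {p : ℕ} : SelfDelim (Kripke.enc (p := p)) :=
  (selfDelim_encList (selfDelim_encBool.prod
    (selfDelim_encLabel.prod (selfDelim_encList selfDelim_encBinary)))).comp
    Kripke.table_injective

theorem CGS.table_injective {k p : ℕ} : Function.Injective (CGS.table (k := k) (p := p)) := by
  rintro ⟨n, i, l, d, hd, δ⟩ ⟨n', i', l', d', hd', δ'⟩ h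
  obtain rfl : n = n' := by simpa [CGS.table] using congrArg List.length h
  have h := fun q => congrFun (List.ofFn_injective h) q
  simp only [Prod.mk.injEq, decide_eq_decide] at h
  obtain rfl : i = i' := Finset.ext fun q => (h q).1
  obtain rfl : l = l' := funext fun q => (h q).2.1
  obtain rfl : d = d' := funext fun q => List.ofFn_injective (h q).2.2.1
  obtain rfl : δ = δ' := by
    funext q α
    have := congrFun (List.ofFn_injective (h q).2.2.2) (finPiFinEquiv α)
    simpa [Fin.ext_iff] using this
  rfl

theorem CGS.selfDelim_enc {k p : ℕ} : SelfDelim (CGS.enc (k := k) (p := p)) :=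
  (selfDelim_encList (selfDelim_encBool.prod (selfDelim_encLabel.prod
    ((selfDelim_encList selfDelim_encUnary).prod (selfDelim_encList selfDelim_encBinary))))).comp
    CGS.table_injective

/-! ### Decision problems and logarithmic-space reductions -/

/-- A decision problem: instances, written as words over `{0,1}`, and the set of the positive
ones. -/
structure DecisionProblem where
  Inst : Type
  enc : Inst → List Bool
  enc_injective : Function.Injective enc
  Yes : Inst → Prop

inductive Dir
  | left | stay | right

/-- The symbols on the read-only input tape, which is delimited by end markers. -/
inductive InSym
  | leftEnd
  | bit (b : Bool)
  | rightEnd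

/-- Deterministic Turing machines with a two-way read-only input tape, finitely many one-way
infinite work tapes, and a write-only output tape. In one step a machine may append a word to the
output. The value `none` of `step` means that the machine halts. -/
structure Transducer where
  State : Type
  Work : Type
  [finState : Finite State]
  [finWork : Finite Work]
  blank : Work
  tapes : ℕ
  start : State
  step : State → InSym → (Fin tapes → Work) →
    Option (State × Dir × (Fin tapes → Work × Dir) × List Bool)

def Dir.move : Dir → ℕ → ℕ
  | .left, i => i - 1
  | .stay, i => i
  | .right, i => i + 1

/-- The symbol in cell `i` of the input tape: cell `0` holds the left end marker, and cells
`1, …, |x|` hold `x`. -/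
def inputAt (x : List Bool) : ℕ → InSym
  | 0 => .leftEnd
  | i + 1 => match x[i]? with
    | some b => .bit b
    | none => .rightEnd

namespace Transducer

structure Config (M : Transducer) where
  state : M.State
  inHead : ℕ
  head : Fin M.tapes → ℕ
  tape : Fin M.tapes → ℕ → M.Work
  out : List Bool

def initial (M : Transducer) : M.Config where
  state := M.start
  inHead := 0
  head := fun _ => 0
  tape := fun _ _ => M.blank
  out := []

/-- The next configuration on input `x`, or `none` if the machine has halted. The input head
stays within the end markers. -/
def next (M : Transducer) (x : List Bool) (c : M.Config) : Option M.Config :=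
  (M.step c.state (inputAt x c.inHead) fun t => c.tape t (c.head t)).map fun r =>
    { state := r.1
      inHead := min (r.2.1.move c.inHead) (x.length + 1)
      head := fun t => (r.2.2.1 t).2.move (c.head t)
      tape := fun t => Function.update (c.tape t) (c.head t) (r.2.2.1 t).1
      out := c.out ++ r.2.2.2 }

def Reaches (M : Transducer) (x : List Bool) : M.Config → M.Config → Prop :=
  Relation.ReflTransGen fun c c' => M.next x c = some c'

/-- On input `x` the machine halts with output `y`, and during the whole computation the heads
only visit the first `s` cells of each work tape. -/
def ComputesInSpace (M : Transducer) (x y : List Bool) (s : ℕ) : Prop :=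
  (∃ c, M.Reaches x M.initial c ∧ M.next x c = none ∧ c.out = y) ∧
    ∀ c, M.Reaches x M.initial c → ∀ t, c.head t < s

end Transducer

/-- `f` is a many-one reduction from `A` to `B` which a Turing machine computes in space
`O(log n)`. -/
def IsLogspaceReduction (A B : DecisionProblem) (f : A.Inst → B.Inst) : Prop :=
  (∀ I, A.Yes I ↔ B.Yes (f I)) ∧
    ∃ (M : Transducer) (c : ℕ), ∀ I,
      M.ComputesInSpace (A.enc I) (B.enc (f I)) (c * (Nat.log 2 (A.enc I).length + 1))

/-- `B` is at least as hard as `A` under logarithmic-space reductions. -/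
def LogspaceReducible (A B : DecisionProblem) : Prop :=
  ∃ f : A.Inst → B.Inst, IsLogspaceReduction A B f

/-! ### Learning problems -/

/-- Inputs of the learning problems: a non-empty set `Fin numProp` of propositions, finite sets of
positive and negative models (given as lists), and a bound on the size. -/
structure LearnInst (Model : ℕ → Type) where
  numProp : ℕ
  numProp_pos : 0 < numProp
  pos : List (Model numProp)
  neg : List (Model numProp)
  bound : ℕ

/-- The bound is written in unary. -/
def LearnInst.enc {Model : ℕ → Type} (e : ∀ p, Model p → List Bool) (I : LearnInst Model) :
    List Bool :=
  encUnary I.numProp ++ (encList (e _) I.pos ++ (encList (e _) I.neg ++ encUnary I.bound))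

theorem LearnInst.enc_injective {Model : ℕ → Type} {e : ∀ p, Model p → List Bool}
    (he : ∀ p, SelfDelim (e p)) : Function.Injective (LearnInst.enc e) := by
  rintro ⟨p, hp, P, N, B⟩ ⟨p', hp', P', N', B'⟩ h
  obtain ⟨h₀, h₁⟩ := selfDelim_encUnary _ _ _ _ h
  dsimp only at h₀
  subst h₀
  obtain ⟨rfl, h₂⟩ := selfDelim_encList (he _) _ _ _ _ h₁
  obtain ⟨rfl, h₃⟩ := selfDelim_encList (he _) _ _ _ _ h₂
  obtain rfl := selfDelim_encUnary.injective h₃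
  rfl

/-- `φ` accepts all the models in `pos` and rejects all those in `neg`. -/
def Separates {Model Form : Type} (sat : Model → Form → Prop) (pos neg : List Model)
    (φ : Form) : Prop :=
  (∀ X ∈ pos, sat X φ) ∧ ∀ X ∈ neg, ¬ sat X φ

def LTLLearn (Ut : Set UnOp) (Bt : Set TempBin) (Bl : Set LogBin) (n : ℕ∞) :
    DecisionProblem where
  Inst := LearnInst UPWord
  enc := LearnInst.enc fun _ => UPWord.enc
  enc_injective := LearnInst.enc_injective fun _ => UPWord.selfDelim_enc
  Yes I := ∃ φ : LTL I.numProp, φ.InFragment Ut Bt Bl ∧ φ.size ≤ I.bound ∧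
    (φ.nbBin : ℕ∞) ≤ n ∧ Separates (fun w φ => LTL.Sat w.toSeq φ) I.pos I.neg φ

def CTLLearn (Ut : Set UnOp) (Bt : Set TempBin) (Bl : Set LogBin) (n : ℕ∞) :
    DecisionProblem where
  Inst := LearnInst Kripke
  enc := LearnInst.enc fun _ => Kripke.enc
  enc_injective := LearnInst.enc_injective fun _ => Kripke.selfDelim_enc
  Yes I := ∃ φ : CTL I.numProp, φ.InFragment Ut Bt Bl ∧ φ.size ≤ I.bound ∧
    (φ.nbBin : ℕ∞) ≤ n ∧ Separates Kripke.Models I.pos I.neg φ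

def ATLLearn (k : ℕ) (Ut : Set UnOp) (Bt : Set TempBin) (Bl : Set LogBin) (n : ℕ∞) :
    DecisionProblem where
  Inst := LearnInst (CGS k)
  enc := LearnInst.enc fun _ => CGS.enc
  enc_injective := LearnInst.enc_injective fun _ => CGS.selfDelim_enc
  Yes I := ∃ φ : ATL k I.numProp, φ.InFragment Ut Bt Bl ∧ φ.size ≤ I.bound ∧
    (φ.nbBin : ℕ∞) ≤ n ∧ Separates CGS.Models I.pos I.neg φ

/-! ### The lasso of an ultimately periodic word -/

/-- The lasso-shaped Kripke structure of `u · v^ω`: one state per letter of `u` and of `v`, the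
first one being initial; each state leads to the next one, and the last one leads back to the
first letter of `v`. -/
def lasso {p : ℕ} (w : UPWord p) : Kripke p where
  numStates := w.u.length + w.v.length
  init := Finset.univ.filter fun q => q.val = 0
  label q := (w.u ++ w.v).getD q.val ∅
  succ q := Finset.univ.filter fun q' => q'.val =
    if q.val + 1 < w.u.length + w.v.length then q.val + 1 else w.u.length
  succ_nonempty q := by
    have hv := List.length_pos_iff.2 w.v_ne_nil
    refine ⟨⟨if q.val + 1 < w.u.length + w.v.length then q.val + 1 else w.u.length, ?_⟩, ?_⟩
    · split_ifs <;> omega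
    · simp

/-- Replace each word by its lasso. -/
def LearnInst.toLassos (I : LearnInst UPWord) : LearnInst Kripke where
  numProp := I.numProp
  numProp_pos := I.numProp_pos
  pos := I.pos.map lasso
  neg := I.neg.map lasso
  bound := I.bound

end LearnTL

/-!
On a structure in which each state has a single successor, all path and strategic quantifiers
collapse: a branching formula holds at a state iff the LTL formula obtained by erasing its
quantifiers holds along the only path from there. Erasing the quantifiers, or putting a fixed one in
front of each temporal operator, maps the subformulas of a formula onto those of its image, so it
increases neither their number nor the number of those with a binary main operator. Hence a word and
its lasso are separated by formulas with the same bounds.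

The `i`-th state of the lasso of `u · v^ω` is followed by the state `i + 1`, except for the last
one, which is followed by `|u|`. A transducer that reads the word letter by letter therefore only
has to store the number of letters read so far, in binary, and next to it a copy of this number that
is frozen at the end of `u`. For `ATL`, each agent has a single action in each state, which only
adds a constant word to the encoding of each state.
-/

namespace LearnTL

/-! ### Branching formulas on structures with a single path -/

namespace BForm

variable {p : ℕ} {Qt : Type}

/-- The LTL formula obtained by removing all the quantifiers. -/
def erase : BForm p Qt → LTL p
  | atom x => .atom x
  | neg φ => .neg φ.erase
  | tempUn _ t φ => .tempUn t φ.erase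
  | tempBin _ t φ ψ => .tempBin t φ.erase ψ.erase
  | logBin b φ ψ => .logBin b φ.erase ψ.erase

theorem inFragment_erase (Ut : Set UnOp) (Bt : Set TempBin) (Bl : Set LogBin) (φ : BForm p Qt) :
    φ.erase.InFragment Ut Bt Bl ↔ φ.InFragment Ut Bt Bl := by
  induction φ <;> simp_all [erase, InFragment, LTL.InFragment]

theorem isBin_erase (φ : BForm p Qt) : φ.erase.isBin = φ.isBin := by
  cases φ <;> rfl

theorem subF_erase [DecidableEq Qt] (φ : BForm p Qt) :
    φ.erase.subF = φ.subF.image erase := by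
  induction φ <;> simp_all [erase, subF, LTL.subF, Finset.image_insert, Finset.image_union]

theorem size_erase_le [DecidableEq Qt] (φ : BForm p Qt) : φ.erase.size ≤ φ.size := by
  rw [LTL.size, subF_erase]
  exact Finset.card_image_le

theorem nbBin_erase_le [DecidableEq Qt] (φ : BForm p Qt) : φ.erase.nbBin ≤ φ.nbBin := by
  rw [LTL.nbBin, subF_erase, Finset.filter_image]
  simp only [isBin_erase]
  exact Finset.card_image_le

theorem sat_iff_sat_erase_iterate {Q : Type} {label : Q → Finset (Fin p)}
    {quant : Qt → Q → Set (ℕ → Q) → Prop} {f : Q → Q}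
    (hquant : ∀ A q T, quant A q T ↔ (fun i => f^[i] q) ∈ T) (φ : BForm p Qt) (q : Q) :
    φ.Sat label quant q ↔ φ.erase.Sat fun i => label (f^[i] q) := by
  have iterate_add : ∀ q i j, f^[i + j] q = f^[j] (f^[i] q) := fun q i j => by
    rw [Nat.add_comm, Function.iterate_add_apply]
  induction φ generalizing q with
  | atom x => rfl
  | neg φ ih => simp only [Sat, LTL.Sat, erase, ih]
  | tempUn A t φ ih =>
    simp only [Sat, LTL.Sat, erase, hquant, Set.mem_ofPred_eq, ih, iterate_add]
  | tempBin A t φ ψ ihφ ihψ =>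
    simp only [Sat, LTL.Sat, erase, hquant, Set.mem_ofPred_eq, ihφ, ihψ, iterate_add]
  | logBin b φ ψ ihφ ihψ => simp only [Sat, LTL.Sat, erase, ihφ, ihψ]

end BForm

namespace LTL

variable {p : ℕ} {Qt : Type}

/-- The branching formula obtained by putting the quantifier `A` in front of each temporal
operator. -/
def quantify (A : Qt) : LTL p → BForm p Qt
  | atom x => .atom x
  | neg φ => .neg (φ.quantify A)
  | tempUn t φ => .tempUn A t (φ.quantify A)
  | tempBin t φ ψ => .tempBin A t (φ.quantify A) (ψ.quantify A)
  | logBin b φ ψ => .logBin b (φ.quantify A) (ψ.quantify A)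

theorem erase_quantify (A : Qt) (φ : LTL p) : (φ.quantify A).erase = φ := by
  induction φ <;> simp_all [quantify, BForm.erase]

theorem inFragment_quantify (Ut : Set UnOp) (Bt : Set TempBin) (Bl : Set LogBin) (A : Qt)
    (φ : LTL p) : (φ.quantify A).InFragment Ut Bt Bl ↔ φ.InFragment Ut Bt Bl := by
  rw [← BForm.inFragment_erase, erase_quantify]

theorem isBin_quantify (A : Qt) (φ : LTL p) : (φ.quantify A).isBin = φ.isBin := by
  cases φ <;> rfl

theorem subF_quantify [DecidableEq Qt] (A : Qt) (φ : LTL p) :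
    (φ.quantify A).subF = φ.subF.image (quantify A) := by
  induction φ <;>
    simp_all [quantify, subF, BForm.subF, Finset.image_insert, Finset.image_union]

theorem size_quantify_le [DecidableEq Qt] (A : Qt) (φ : LTL p) :
    (φ.quantify A).size ≤ φ.size := by
  rw [BForm.size, subF_quantify]
  exact Finset.card_image_le

theorem nbBin_quantify_le [DecidableEq Qt] (A : Qt) (φ : LTL p) :
    (φ.quantify A).nbBin ≤ φ.nbBin := by
  rw [BForm.nbBin, subF_quantify, Finset.filter_image]
  simp only [isBin_quantify]
  exact Finset.card_image_le

end LTL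

theorem separates_map_iff {Word Model Form Form' : Type} {sat : Word → Form → Prop}
    {sat' : Model → Form' → Prop} {g : Word → Model} {φ : Form} {φ' : Form'}
    (hg : ∀ w, sat' (g w) φ' ↔ sat w φ) (pos neg : List Word) :
    Separates sat' (pos.map g) (neg.map g) φ' ↔ Separates sat pos neg φ := by
  simp only [Separates, List.forall_mem_map, hg]

theorem exists_separating_iff_of_sat_erase {p : ℕ} {Qt Word Model : Type} [DecidableEq Qt] (A : Qt)
    {sat : Word → LTL p → Prop} {sat' : Model → BForm p Qt → Prop} {g : Word → Model}
    (hg : ∀ w φ, sat' (g w) φ ↔ sat w φ.erase) (Ut : Set UnOp) (Bt : Set TempBin)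
    (Bl : Set LogBin) (n : ℕ∞) (pos neg : List Word) (B : ℕ) :
    (∃ φ : LTL p, φ.InFragment Ut Bt Bl ∧ φ.size ≤ B ∧ (φ.nbBin : ℕ∞) ≤ n ∧
        Separates sat pos neg φ) ↔
      ∃ φ : BForm p Qt, φ.InFragment Ut Bt Bl ∧ φ.size ≤ B ∧ (φ.nbBin : ℕ∞) ≤ n ∧
        Separates sat' (pos.map g) (neg.map g) φ := by
  constructor
  · rintro ⟨φ, hfragment, hsize, hbin, hsep⟩
    refine ⟨φ.quantify A, (φ.inFragment_quantify Ut Bt Bl A).2 hfragment,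
      (φ.size_quantify_le A).trans hsize,
      (Nat.cast_le.2 (φ.nbBin_quantify_le A)).trans hbin, (separates_map_iff ?_ pos neg).2 hsep⟩
    intro w
    rw [hg, LTL.erase_quantify]
  · rintro ⟨φ, hfragment, hsize, hbin, hsep⟩
    exact ⟨φ.erase, (φ.inFragment_erase Ut Bt Bl).2 hfragment, φ.size_erase_le.trans hsize,
      (Nat.cast_le.2 φ.nbBin_erase_le).trans hbin,
      (separates_map_iff (fun w => hg w φ) pos neg).1 hsep⟩

theorem orbit_iff_eq_iterate {Q : Type} {f : Q → Q} {ρ : ℕ → Q} {q : Q} :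
    (ρ 0 = q ∧ ∀ i, ρ (i + 1) = f (ρ i)) ↔ ρ = fun i => f^[i] q := by
  constructor
  · rintro ⟨hzero, hsucc⟩
    funext i
    induction i with
    | zero => exact hzero
    | succ i ih => rw [hsucc, ih, Function.iterate_succ_apply']
  · rintro rfl
    exact ⟨rfl, fun i => Function.iterate_succ_apply' ..⟩

namespace Kripke

variable {p : ℕ} {K : Kripke p} {f : Fin K.numStates → Fin K.numStates}

theorem out_eq_singleton_iterate (hf : ∀ q, K.succ q = {f q}) (q : Fin K.numStates) :
    K.Out q = {fun i => f^[i] q} := by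
  ext ρ
  simp only [Out, hf, Finset.mem_singleton, Set.mem_ofPred_eq, Set.mem_singleton_iff,
    orbit_iff_eq_iterate]

theorem models_iff_sat_erase_iterate (hf : ∀ q, K.succ q = {f q}) {q₀ : Fin K.numStates}
    (hinit : K.init = {q₀}) (φ : CTL p) :
    K.Models φ ↔ φ.erase.Sat fun i => K.label (f^[i] q₀) := by
  have hquant : ∀ A q T, K.Quant A q T ↔ (fun i => f^[i] q) ∈ T := by
    intro A q T
    cases A <;> simp [Quant, out_eq_singleton_iterate hf]
  simp only [Models, hinit, Finset.mem_singleton, forall_eq,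
    BForm.sat_iff_sat_erase_iterate hquant]

end Kripke

namespace CGS

variable {k p : ℕ} {C : CGS k p} {f : Fin C.numStates → Fin C.numStates}

theorem succ_eq_singleton (hf : ∀ q β, C.δ q β = f q) (A : Finset (Fin k)) (q : Fin C.numStates)
    (α : (a : Fin k) → a ∈ A → Fin (C.d q a)) : C.Succ A q α = {f q} := by
  classical
  let extension : (a : Fin k) → Fin (C.d q a) := fun a =>
    if h : a ∈ A then α a h else ⟨0, C.d_pos q a⟩
  have hextension : ∀ a (h : a ∈ A), extension a = α a h := fun a h => dif_pos h
  ext q'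
  simp only [Succ, hf, Set.mem_ofPred_eq, Set.mem_singleton_iff]
  exact ⟨fun ⟨_, _, h⟩ => h.symm, fun h => ⟨extension, hextension, h.symm⟩⟩

theorem out_eq_singleton_iterate (hf : ∀ q β, C.δ q β = f q) {A : Finset (Fin k)}
    (q : Fin C.numStates) (s : C.Profile A) : C.Out q s = {fun i => f^[i] q} := by
  ext ρ
  simp only [Out, succ_eq_singleton hf, Set.mem_ofPred_eq, Set.mem_singleton_iff,
    orbit_iff_eq_iterate]

theorem models_iff_sat_erase_iterate (hf : ∀ q β, C.δ q β = f q) {q₀ : Fin C.numStates}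
    (hinit : C.init = {q₀}) (φ : ATL k p) :
    C.Models φ ↔ φ.erase.Sat fun i => C.label (f^[i] q₀) := by
  have hquant : ∀ A q T, C.Quant A q T ↔ (fun i => f^[i] q) ∈ T := by
    intro A q T
    simp only [Quant, out_eq_singleton_iterate hf, Set.mem_singleton_iff, forall_eq]
    exact ⟨fun ⟨_, h⟩ => h, fun h => ⟨fun a _ _ q => ⟨0, C.d_pos q a⟩, h⟩⟩
  simp only [Models, hinit, Finset.mem_singleton, forall_eq,
    BForm.sat_iff_sat_erase_iterate hquant]

end CGS

/-! ### Lassos -/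

namespace UPWord

variable {p : ℕ} (w : UPWord p)

theorem length_v_pos : 0 < w.v.length := List.length_pos_iff.2 w.v_ne_nil

/-- The only successor of a state of the lasso. -/
def nextState (q : Fin (lasso w).numStates) : Fin (lasso w).numStates where
  val := if q.val + 1 < w.u.length + w.v.length then q.val + 1 else w.u.length
  isLt := by
    have := w.length_v_pos
    change _ < w.u.length + w.v.length
    split_ifs <;> omega

/-- The only initial state of the lasso. -/
def firstState : Fin (lasso w).numStates :=
  ⟨0, Nat.add_pos_right _ w.length_v_pos⟩

theorem succ_lasso (q : Fin (lasso w).numStates) : (lasso w).succ q = {w.nextState q} := by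
  ext q'
  rw [Finset.mem_singleton, Fin.ext_iff]
  exact Finset.mem_filter_univ q'

theorem init_lasso : (lasso w).init = {w.firstState} := by
  ext q
  rw [Finset.mem_singleton, Fin.ext_iff]
  exact Finset.mem_filter_univ q

theorem val_nextState (q : Fin (lasso w).numStates) :
    (w.nextState q).val =
      if q.val + 1 < w.u.length + w.v.length then q.val + 1 else w.u.length := rfl

theorem val_iterate_nextState (i : ℕ) :
    (w.nextState^[i] w.firstState).val =
      if i < w.u.length then i else w.u.length + (i - w.u.length) % w.v.length := by
  have hv := w.length_v_pos
  induction i with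
  | zero => simp +contextual [firstState]
  | succ i ih =>
    rw [Function.iterate_succ_apply', val_nextState, ih]
    rcases lt_or_ge i w.u.length with hi | hi
    · rcases Nat.lt_or_eq_of_le (Nat.add_one_le_iff.2 hi) with hi' | hi'
      · rw [if_pos hi, if_pos hi', if_pos (by omega)]
      · rw [if_pos hi, if_pos (by omega), if_neg (by omega), hi', Nat.sub_self, Nat.zero_mod,
          Nat.add_zero]
    · obtain ⟨j, rfl⟩ := Nat.exists_eq_add_of_le hi
      have hj : j % w.v.length < w.v.length := Nat.mod_lt j hv
      have hsub : w.u.length + j + 1 - w.u.length = j + 1 := by omega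
      rw [if_neg hi.not_gt, Nat.add_sub_cancel_left,
        if_neg (c := w.u.length + j + 1 < w.u.length) (by omega), hsub, ← Nat.mod_add_mod]
      rcases Nat.lt_or_eq_of_le (Nat.add_one_le_iff.2 hj) with hj' | hj'
      · rw [if_pos (by omega), Nat.mod_eq_of_lt hj', Nat.add_assoc]
      · rw [if_neg (by omega), hj', Nat.mod_self, Nat.add_zero]

theorem label_iterate_nextState (i : ℕ) :
    (lasso w).label (w.nextState^[i] w.firstState) = w.toSeq i := by
  change (w.u ++ w.v).getD (w.nextState^[i] w.firstState).val ∅ = _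
  rw [val_iterate_nextState, toSeq]
  split_ifs with hi
  · rw [List.getD_append _ _ _ _ hi]
  · rw [List.getD_append_right _ _ _ _ (Nat.le_add_right ..), Nat.add_sub_cancel_left]

end UPWord

theorem models_lasso_iff {p : ℕ} (w : UPWord p) (φ : CTL p) :
    (lasso w).Models φ ↔ φ.erase.Sat w.toSeq := by
  rw [Kripke.models_iff_sat_erase_iterate w.succ_lasso w.init_lasso,
    funext w.label_iterate_nextState]

/-- The lasso of a word as a concurrent game structure: each agent always has one action, so that
no agent has any influence. -/
abbrev gameLasso (k : ℕ) {p : ℕ} (w : UPWord p) : CGS k p where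
  numStates := (lasso w).numStates
  init := (lasso w).init
  label := (lasso w).label
  d _ _ := 1
  d_pos _ _ := Nat.one_pos
  δ q _ := w.nextState q

theorem models_gameLasso_iff {k p : ℕ} (w : UPWord p) (φ : ATL k p) :
    (gameLasso k w).Models φ ↔ φ.erase.Sat w.toSeq := by
  have hlabel : (fun i => (gameLasso k w).label (w.nextState^[i] w.firstState)) = w.toSeq :=
    funext w.label_iterate_nextState
  rw [CGS.models_iff_sat_erase_iterate (C := gameLasso k w) (f := w.nextState) (fun _ _ => rfl)
    w.init_lasso, hlabel]

/-- The instance obtained by replacing each model by its image under `g`. -/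
def LearnInst.map {Model Model' : ℕ → Type} (g : ∀ p, Model p → Model' p) (I : LearnInst Model) :
    LearnInst Model' where
  numProp := I.numProp
  numProp_pos := I.numProp_pos
  pos := I.pos.map (g _)
  neg := I.neg.map (g _)
  bound := I.bound

/-! ### Rows of the table of a lasso -/

theorem encList_eq_flatMap {α : Type} (e : α → List Bool) (l : List α) :
    encList e l = (l.flatMap fun a => true :: e a) ++ [false] := by
  induction l with
  | nil => rfl
  | cons a l ih => simp [encList, ih]

theorem encList_map {α β : Type} (e : β → List Bool) (g : α → β) (l : List α) :
    encList e (l.map g) = encList (fun a => e (g a)) l := by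
  rw [encList_eq_flatMap, encList_eq_flatMap, List.flatMap_map]

theorem length_le_length_encList {α : Type} (e : α → List Bool) (l : List α) :
    l.length ≤ (encList e l).length := by
  induction l with
  | nil => exact Nat.zero_le _
  | cons a l ih => simp [encList]; omega

theorem length_le_length_encList_of_mem {α : Type} (e : α → List Bool) {a : α} {l : List α}
    (ha : a ∈ l) : (e a).length ≤ (encList e l).length := by
  induction ha with
  | head l => simp [encList]; omega
  | tail b _ ih => simp [encList]; omega

/-- The encoding of the row of a state: whether it is initial, its label `a`, its only successor
`m`. The word `moves` stands for the columns in between, which are the same for all states: there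
are none in a Kripke structure, and in a game structure they give the numbers of actions. -/
def lassoRow (moves : List Bool) {p : ℕ} (isInit : Bool) (a : Finset (Fin p)) (m : ℕ) :
    List Bool :=
  encBool isInit ++ (encLabel a ++ (moves ++ encList encBinary [m]))

/-- The rows of consecutive states `n, n + 1, …` labelled by `l`, each of which leads to the next
one. -/
def chainRows (moves : List Bool) {p : ℕ} (n : ℕ) (l : List (Finset (Fin p))) :
    List (List Bool) :=
  (l.zipIdx n).map fun a => lassoRow moves (a.2 == 0) a.1 (a.2 + 1)

/-- The rows of all the states of the lasso of `w`. -/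
def lassoRows (moves : List Bool) {p : ℕ} (w : UPWord p) : List (List Bool) :=
  chainRows moves 0 (w.u ++ w.v.dropLast) ++
    [lassoRow moves (w.u.length + w.v.dropLast.length == 0) (w.v.getLast w.v_ne_nil) w.u.length]

theorem chainRows_append (moves : List Bool) {p n : ℕ} (l m : List (Finset (Fin p))) :
    chainRows moves n (l ++ m) = chainRows moves n l ++ chainRows moves (n + l.length) m := by
  simp only [chainRows, List.zipIdx_append, List.map_append]

theorem UPWord.enc_append {p : ℕ} (w : UPWord p) (r : List Bool) :
    w.enc ++ r = (w.u.flatMap fun a => true :: encLabel a) ++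
      false :: ((w.v.dropLast.flatMap fun a => true :: encLabel a) ++
        true :: (encLabel (w.v.getLast w.v_ne_nil) ++ false :: r)) := by
  conv_lhs => rw [enc, ← List.dropLast_append_getLast w.v_ne_nil]
  simp [encList_eq_flatMap]

theorem encList_lassoRows (moves : List Bool) {p : ℕ} (w : UPWord p) :
    encList id (lassoRows moves w) =
      ((chainRows moves 0 w.u).flatMap fun row => true :: row) ++
        (((chainRows moves w.u.length w.v.dropLast).flatMap fun row => true :: row) ++
          true :: (lassoRow moves (w.u.length + w.v.dropLast.length == 0)
            (w.v.getLast w.v_ne_nil) w.u.length ++ [false])) := by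
  simp [encList_eq_flatMap, lassoRows, chainRows_append]

theorem ofFn_lassoRow (moves : List Bool) {p : ℕ} (w : UPWord p) :
    (List.ofFn fun q : Fin (lasso w).numStates =>
      lassoRow moves (decide (q ∈ (lasso w).init)) ((lasso w).label q) (w.nextState q).val) =
      lassoRows moves w := by
  have hv := w.length_v_pos
  have hletters : w.u ++ w.v = (w.u ++ w.v.dropLast) ++ [w.v.getLast w.v_ne_nil] := by
    rw [List.append_assoc, List.dropLast_append_getLast]
  have hlength : (lasso w).numStates = (w.u ++ w.v.dropLast).length + 1 := by
    simp only [lasso, List.length_append, List.length_dropLast]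
    omega
  have hinit : ∀ q, decide (q ∈ (lasso w).init) = (q.val == 0) := fun q => by
    rw [Bool.eq_iff_iff, decide_eq_true_iff, beq_iff_eq, w.init_lasso, Finset.mem_singleton,
      Fin.ext_iff]
    rfl
  refine List.ext_getElem (by simp [lassoRows, chainRows, hlength]) fun i hi _ => ?_
  rw [List.length_ofFn, hlength] at hi
  rw [List.getElem_ofFn, hinit]
  simp only [lasso, UPWord.nextState, lassoRows]
  rcases Nat.lt_or_eq_of_le (Nat.le_of_lt_succ hi) with hi' | hi'
  · have hnext : i + 1 < w.u.length + w.v.length := by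
      simp only [List.length_append, List.length_dropLast] at hi'
      omega
    rw [hletters, if_pos hnext, List.getD_append _ _ _ _ hi', List.getElem_append_left]
    · simp [chainRows, List.getElem?_eq_getElem hi']
    · simpa [chainRows] using hi'
  · have hlast : ¬ i + 1 < w.u.length + w.v.length := by
      simp only [List.length_append, List.length_dropLast] at hi'
      omega
    rw [hletters, if_neg hlast]
    subst hi'
    simp [chainRows]

theorem enc_lasso {p : ℕ} (w : UPWord p) : (lasso w).enc = encList id (lassoRows [] w) := by
  have hsucc : ∀ q, (List.finRange (lasso w).numStates).filter (· ∈ (lasso w).succ q) =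
      [w.nextState q] := fun q => by
    simp only [w.succ_lasso, Finset.mem_singleton, List.filter_eq]
    rw [List.count_eq_one_of_mem (List.nodup_finRange _) (List.mem_finRange _)]
    rfl
  rw [← ofFn_lassoRow, Kripke.enc, Kripke.table]
  simp only [hsucc]
  refine (encList_map id _ _).symm.trans ?_
  rw [List.map_ofFn]
  rfl

theorem enc_gameLasso (k : ℕ) {p : ℕ} (w : UPWord p) :
    (gameLasso k w).enc =
      encList id (lassoRows (encList encUnary (List.replicate k 1)) w) := by
  have hδ : ∀ q, (List.ofFn fun j : Fin (∏ a, (gameLasso k w).d q a) =>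
      ((gameLasso k w).δ q (finPiFinEquiv.symm j)).val) = [(w.nextState q).val] := fun q => by
    have hone : ∏ a, (gameLasso k w).d q a = 1 := Finset.prod_const_one
    exact (List.ofFn_const _ _).trans (by rw [hone]; rfl)
  rw [← ofFn_lassoRow, CGS.enc, CGS.table]
  simp only [hδ, List.ofFn_const]
  refine (encList_map id _ _).symm.trans ?_
  rw [List.map_ofFn]
  rfl

/-! ### Computations in bounded space -/

namespace Transducer

variable {M : Transducer} {x : List Bool} {s : ℕ} {c c' c'' : M.Config}

variable (M x s) in
/-- `M` goes from one configuration to another one, and before each step its heads are in the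
first `s` cells. -/
def RunsInSpace : M.Config → M.Config → Prop :=
  Relation.ReflTransGen fun c c' => M.next x c = some c' ∧ ∀ t, c.head t < s

theorem RunsInSpace.reaches (h : M.RunsInSpace x s c c') : M.Reaches x c c' :=
  Relation.ReflTransGen.mono (fun _ _ h => h.1) _ _ h

theorem RunsInSpace.trans (h : M.RunsInSpace x s c c') (h' : M.RunsInSpace x s c' c'') :
    M.RunsInSpace x s c c'' :=
  Relation.ReflTransGen.trans h h'

theorem RunsInSpace.head_lt (h : M.RunsInSpace x s c c') (hhalt : M.next x c' = none)
    (hs : ∀ t, c'.head t < s) (h' : M.Reaches x c c'') : ∀ t, c''.head t < s := by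
  induction h using Relation.ReflTransGen.head_induction_on with
  | refl =>
    rcases Relation.ReflTransGen.cases_head h' with rfl | ⟨d, hd, -⟩
    · exact hs
    · cases hhalt.symm.trans hd
  | head hstep _ ih =>
    rcases Relation.ReflTransGen.cases_head h' with rfl | ⟨d, hd, hreaches⟩
    · exact hstep.2
    · cases hstep.1.symm.trans hd
      exact ih hreaches

theorem RunsInSpace.computesInSpace (h : M.RunsInSpace x s M.initial c)
    (hhalt : M.next x c = none) (hs : ∀ t, c.head t < s) : M.ComputesInSpace x c.out s :=
  ⟨⟨c, h.reaches, hhalt, rfl⟩, fun _ h' => h.head_lt hhalt hs h'⟩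

end Transducer

/-! ### A binary counter with two tracks -/

/-- The sum of a carry and of the number with the given binary digits, least significant first. -/
def addCarry : Bool → List Bool → List Bool
  | false, [] => []
  | true, [] => [true]
  | carry, b :: l => (b ^^ carry) :: addCarry (b && carry) l

theorem addCarry_false (l : List Bool) : addCarry false l = l := by
  induction l <;> simp_all [addCarry]

theorem addCarry_true_bits (n : ℕ) : addCarry true n.bits = (n + 1).bits := by
  induction n using Nat.binaryRec' with
  | zero => simp [addCarry]
  | bit b n hn ih =>
    rw [Nat.bits_append_bit n b hn, addCarry]
    cases b
    · simp [addCarry_false, Nat.bit]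
    · have hsucc : Nat.bit true n + 1 = 2 * (n + 1) := by simp [Nat.bit]; ring
      rw [hsucc, Nat.bit0_bits _ (by omega)]
      simp [ih]

theorem size_le_log_add_one {n m : ℕ} (h : n ≤ m) : n.size ≤ Nat.log 2 m + 1 :=
  Nat.size_le.2 (h.trans_lt (Nat.lt_pow_succ_log_self one_lt_two m))

/-- The two lists that form a word `u · v^ω`: `u` is the stem and `v` is the loop. -/
inductive WordPart
  | stem | loop
  deriving DecidableEq

instance : Fintype WordPart := ⟨{.stem, .loop}, fun part => by cases part <;> decide⟩

/-- The digits, in the same position, of two numbers. The first one is the number of letters of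
the current word that have been read. The second one, which may have fewer digits, is the number of
those which belong to the stem. -/
abbrev CounterDigit : Type := Bool × Option Bool

/-- Add a carry to a digit of the number of letters. In the stem, the second digit is kept equal to
the first one. -/
def incDigit (part : WordPart) (carry : Bool) (a : CounterDigit) : CounterDigit :=
  (a.1 ^^ carry, match part with
    | .stem => some (a.1 ^^ carry)
    | .loop => a.2)

/-- Add a carry to the number of letters, least significant digit first. -/
def incCounter (part : WordPart) : Bool → List CounterDigit → List CounterDigit
  | false, [] => []
  | true, [] => [incDigit part true (false, none)]
  | carry, a :: l => incDigit part carry a :: incCounter part (a.1 && carry) l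

theorem map_fst_incCounter (part : WordPart) (carry : Bool) (l : List CounterDigit) :
    (incCounter part carry l).map Prod.fst = addCarry carry (l.map Prod.fst) := by
  induction l generalizing carry with
  | nil => cases carry <;> rfl
  | cons a l ih => simp [incCounter, addCarry, incDigit, ih]

theorem filterMap_snd_incCounter_stem (carry : Bool) (l : List CounterDigit) :
    (incCounter .stem carry l).filterMap Prod.snd = addCarry carry (l.map Prod.fst) := by
  induction l generalizing carry with
  | nil => cases carry <;> rfl
  | cons a l ih => simp [incCounter, addCarry, incDigit, ih]

theorem filterMap_snd_incCounter_loop (carry : Bool) (l : List CounterDigit) :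
    (incCounter .loop carry l).filterMap Prod.snd = l.filterMap Prod.snd := by
  induction l generalizing carry with
  | nil => cases carry <;> rfl
  | cons a l ih => simp [incCounter, incDigit, List.filterMap_cons, ih]

theorem map_fst_iterate_incCounter (part : WordPart) {n : ℕ} {l : List CounterDigit}
    (hl : l.map Prod.fst = n.bits) (i : ℕ) :
    ((incCounter part true)^[i] l).map Prod.fst = (n + i).bits := by
  induction i with
  | zero => exact hl
  | succ i ih =>
    rw [Function.iterate_succ_apply', map_fst_incCounter, ih, addCarry_true_bits, Nat.add_assoc]

theorem filterMap_snd_iterate_incCounter_stem (i : ℕ) :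
    ((incCounter .stem true)^[i] []).filterMap Prod.snd = i.bits := by
  cases i with
  | zero => rfl
  | succ i =>
    rw [Function.iterate_succ_apply', filterMap_snd_incCounter_stem,
      map_fst_iterate_incCounter (n := 0) .stem rfl, Nat.zero_add, addCarry_true_bits]

theorem filterMap_snd_iterate_incCounter_loop (l : List CounterDigit) (i : ℕ) :
    ((incCounter .loop true)^[i] l).filterMap Prod.snd = l.filterMap Prod.snd := by
  induction i with
  | zero => rfl
  | succ i ih => rw [Function.iterate_succ_apply', filterMap_snd_incCounter_loop, ih]

/-! ### The transducer -/

/-- Which of the two lists of models of an instance is being read. -/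
inductive Polarity
  | pos | neg
  deriving DecidableEq

instance : Fintype Polarity := ⟨{.pos, .neg}, fun side => by cases side <;> decide⟩

/-- Symbols on the work tape, which holds a marker followed by the digits of the counter. -/
inductive Cell
  | blank
  | marker
  | digit (a : CounterDigit)
  deriving Fintype

/-- States of the machine. In `word`, the flag tells whether no letter of the current word has
been read. In `inc`, it is the carry. -/
inductive LassoState
  | start
  | unary
  | list (side : Polarity)
  | word (side : Polarity) (part : WordPart) (first : Bool)
  | label (side : Polarity) (part : WordPart)
  | labelBit (side : Polarity) (part : WordPart)
  | peek (side : Polarity) (part : WordPart)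
  | inc (side : Polarity) (part : WordPart) (carry : Bool)
  | back (side : Polarity) (part : WordPart)
  | flush (side : Polarity)
  | clear (side : Polarity)
  | copy
  deriving Fintype

/-- The state in which the machine leaves a list of words. -/
def LassoState.afterList : Polarity → LassoState
  | .pos => .list .neg
  | .neg => .copy

/-- The transition function. After each label, `peek` tells whether the current letter is the last
one of the loop. If it is not, `inc` increments the counter and writes its first track, which is
then the next state of the lasso. Otherwise `flush` writes the second track, which is the length
of the stem. -/
def lassoStep (moves : List Bool) :
    LassoState → InSym → Cell → Option (LassoState × Dir × (Cell × Dir) × List Bool)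
  | .start, _, _ => some (.unary, .right, (.marker, .right), [])
  | .unary, .bit true, c => some (.unary, .right, (c, .stay), [true])
  | .unary, .bit false, c => some (.list .pos, .right, (c, .stay), [false])
  | .list side, .bit true, c => some (.word side .stem true, .right, (c, .stay), [true])
  | .list side, .bit false, c => some (.afterList side, .right, (c, .stay), [false])
  | .word side part first, .bit true, c =>
      some (.label side part, .right, (c, .stay), true :: encBool first)
  | .word side .stem first, .bit false, c => some (.word side .loop first, .right, (c, .stay), [])
  | .label side part, .bit true, c => some (.labelBit side part, .right, (c, .stay), [true])
  | .label side part, .bit false, c =>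
      some (.peek side part, .right, (c, .stay), false :: (moves ++ [true]))
  | .labelBit side part, .bit b, c => some (.label side part, .right, (c, .stay), encBool b)
  | .peek side .stem, _, c => some (.inc side .stem true, .stay, (c, .stay), [])
  | .peek side .loop, .bit true, c => some (.inc side .loop true, .stay, (c, .stay), [])
  | .peek side .loop, .bit false, c => some (.flush side, .right, (c, .stay), [])
  | .inc side part carry, _, .digit a => some (.inc side part (a.1 && carry), .stay,
      (.digit (incDigit part carry a), .right), true :: encBool (a.1 ^^ carry))
  | .inc side part true, _, .blank => some (.inc side part false, .stay,
      (.digit (incDigit part true (false, none)), .right), true :: encBool true)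
  | .inc side part false, _, .blank => some (.back side part, .stay, (.blank, .left),
      [false, false])
  | .back side part, _, .digit a => some (.back side part, .stay, (.digit a, .left), [])
  | .back side part, _, .marker => some (.word side part false, .stay, (.marker, .right), [])
  | .flush side, _, .digit a => some (.flush side, .stay, (.digit a, .right),
      a.2.elim [] fun b => true :: encBool b)
  | .flush side, _, .blank => some (.clear side, .stay, (.blank, .left), [false, false, false])
  | .clear side, _, .digit _ => some (.clear side, .stay, (.blank, .left), [])
  | .clear side, _, .marker => some (.list side, .stay, (.marker, .right), [])
  | .copy, .bit b, c => some (.copy, .right, (c, .stay), [b])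
  | _, _, _ => none

/-- The machine that replaces the words of an instance by their lassos. The word `moves` has the
same role as in `lassoRow`. -/
def lassoMachine (moves : List Bool) : Transducer where
  State := LassoState
  Work := Cell
  finState := inferInstance
  finWork := inferInstance
  blank := .blank
  tapes := 1
  start := .start
  step q i c := (lassoStep moves q i (c 0)).map fun r => (r.1, r.2.1, fun _ => r.2.2.1, r.2.2.2)

/-- The tape that holds the counter `l` after the marker. -/
def counterTape (l : List CounterDigit) (i : ℕ) : Cell :=
  (Cell.marker :: l.map .digit).getD i .blank

theorem counterTape_length_add_one (l : List CounterDigit) :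
    counterTape l (l.length + 1) = .blank := by
  simp [counterTape]

theorem counterTape_append_cons (l m : List CounterDigit) (a : CounterDigit) :
    counterTape (l ++ a :: m) (l.length + 1) = .digit a := by
  simp [counterTape]

theorem update_counterTape_replace (l m : List CounterDigit) (a b : CounterDigit) :
    Function.update (counterTape (l ++ a :: m)) (l.length + 1) (.digit b) =
      counterTape (l ++ b :: m) := by
  funext i
  rcases i with - | i <;> grind [Function.update_apply, counterTape]

theorem update_counterTape_push (l : List CounterDigit) (a : CounterDigit) :
    Function.update (counterTape l) (l.length + 1) (.digit a) = counterTape (l ++ [a]) := by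
  funext i
  rcases i with - | i <;> grind [Function.update_apply, counterTape]

theorem update_counterTape_pop (l : List CounterDigit) (a : CounterDigit) :
    Function.update (counterTape (l ++ [a])) (l.length + 1) .blank = counterTape l := by
  rw [← update_counterTape_push, Function.update_idem, ← counterTape_length_add_one l,
    Function.update_eq_self]

/-- A configuration of the machine, without its output: the state, the part of the input which is
still to be read, the position of the head of the work tape, and the counter on this tape. -/
structure Snapshot where
  state : LassoState
  rest : List Bool
  head : ℕ
  counter : List CounterDigit

/-- The configuration on input `x` with a given output. -/
def Snapshot.config (moves x : List Bool) (a : Snapshot) (o : List Bool) :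
    (lassoMachine moves).Config where
  state := a.state
  inHead := x.length + 1 - a.rest.length
  head _ := a.head
  tape _ := counterTape a.counter
  out := o

/-- On input `x`, the machine goes from `a` to `b` in space `s` and writes `y`. This is only
required if `a` occurs on input `x`, that is, if what is still to be read is a suffix of `x`. -/
def Emits (moves x : List Bool) (s : ℕ) (a b : Snapshot) (y : List Bool) : Prop :=
  a.rest <:+ x → b.rest <:+ x ∧
    ∀ o, (lassoMachine moves).RunsInSpace x s (a.config moves x o) (b.config moves x (o ++ y))

theorem inputAt_of_isSuffix {r x : List Bool} (h : r <:+ x) :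
    inputAt x (x.length + 1 - r.length) = inputAt r 1 := by
  obtain ⟨y, rfl⟩ := h
  have hposition : (y ++ r).length + 1 - r.length = y.length + 1 := by
    rw [List.length_append]
    omega
  have hget : (y ++ r)[y.length]? = r[0]? := by
    rw [List.getElem?_append_right le_rfl, Nat.sub_self]
  simp only [hposition, inputAt, hget]

section Emits

variable {moves x : List Bool} {s : ℕ}

theorem Emits.refl (a : Snapshot) : Emits moves x s a a [] :=
  fun hx => ⟨hx, fun o => by rw [List.append_nil]; exact Relation.ReflTransGen.refl⟩

theorem Emits.trans {a b c : Snapshot} {y z : List Bool} (h : Emits moves x s a b y)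
    (h' : Emits moves x s b c z) : Emits moves x s a c (y ++ z) := fun hx => by
  obtain ⟨hb, hab⟩ := h hx
  obtain ⟨hc, hbc⟩ := h' hb
  refine ⟨hc, fun o => ?_⟩
  rw [← List.append_assoc]
  exact (hab o).trans (hbc _)

theorem emits_read {q q' : LassoState} {b : Bool} {r y : List Bool} {h : ℕ}
    {l : List CounterDigit} (hs : h < s) (hstep : lassoStep moves q (.bit b) (counterTape l h) =
      some (q', .right, (counterTape l h, .stay), y)) :
    Emits moves x s ⟨q, b :: r, h, l⟩ ⟨q', r, h, l⟩ y := by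
  intro hx
  refine ⟨(List.suffix_cons b r).trans hx, fun o => Relation.ReflTransGen.single ⟨?_, fun _ => hs⟩⟩
  have hlength : r.length + 1 ≤ x.length := hx.length_le
  have hposition : min (x.length + 1 - (r.length + 1) + 1) (x.length + 1) =
      x.length + 1 - r.length := by omega
  have hinput : inputAt x (x.length + 1 - (r.length + 1)) = .bit b := inputAt_of_isSuffix hx
  simp only [Transducer.next, Snapshot.config, lassoMachine, List.length_cons, hinput, hstep,
    Option.map_some, Dir.move, Function.update_eq_self, hposition]

theorem emits_stay {q q' : LassoState} {r y : List Bool} {h h' : ℕ} {l l' : List CounterDigit}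
    {c : Cell} {d : Dir} (hs : h < s) (hstep : lassoStep moves q (inputAt r 1) (counterTape l h) =
      some (q', .stay, (c, d), y)) (hhead : d.move h = h')
    (htape : Function.update (counterTape l) h c = counterTape l') :
    Emits moves x s ⟨q, r, h, l⟩ ⟨q', r, h', l'⟩ y := by
  intro hx
  refine ⟨hx, fun o => Relation.ReflTransGen.single ⟨?_, fun _ => hs⟩⟩
  have hposition : min (Dir.stay.move (x.length + 1 - r.length)) (x.length + 1) =
      x.length + 1 - r.length := min_eq_left (Nat.sub_le ..)
  simp only [Transducer.next, Snapshot.config, lassoMachine, inputAt_of_isSuffix hx, hstep,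
    Option.map_some, hhead, htape, hposition]

theorem emits_digit_right {q q' : LassoState} {r y : List Bool} {l m : List CounterDigit}
    {a b : CounterDigit} (hs : l.length + 1 < s)
    (hstep : lassoStep moves q (inputAt r 1) (.digit a) =
      some (q', .stay, (.digit b, .right), y)) :
    Emits moves x s ⟨q, r, l.length + 1, l ++ a :: m⟩
      ⟨q', r, (l ++ [b]).length + 1, (l ++ [b]) ++ m⟩ y :=
  emits_stay hs (by rwa [counterTape_append_cons]) (by simp [Dir.move])
    (by rw [update_counterTape_replace, List.append_cons])

theorem emits_blank_left {q q' : LassoState} {r y : List Bool} {l : List CounterDigit}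
    (hs : l.length + 1 < s)
    (hstep : lassoStep moves q (inputAt r 1) .blank = some (q', .stay, (.blank, .left), y)) :
    Emits moves x s ⟨q, r, l.length + 1, l⟩ ⟨q', r, l.length, l⟩ y :=
  emits_stay hs (by rwa [counterTape_length_add_one]) rfl
    (by rw [← counterTape_length_add_one l, Function.update_eq_self])

theorem emits_marker_right {q q' : LassoState} {r : List Bool} {l : List CounterDigit}
    (hs : 0 < s)
    (hstep : lassoStep moves q (inputAt r 1) .marker = some (q', .stay, (.marker, .right), [])) :
    Emits moves x s ⟨q, r, 0, l⟩ ⟨q', r, 1, l⟩ [] :=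
  emits_stay hs hstep rfl (Function.update_eq_self 0 (counterTape l))

theorem emits_unary (n : ℕ) {r : List Bool} {h : ℕ} {l : List CounterDigit} (hs : h < s) :
    Emits moves x s ⟨.unary, encUnary n ++ r, h, l⟩ ⟨.list .pos, r, h, l⟩ (encUnary n) := by
  induction n with
  | zero => exact emits_read hs rfl
  | succ n ih => exact Emits.trans (y := [true]) (emits_read hs rfl) ih

theorem emits_label (bs : List Bool) {side : Polarity} {part : WordPart} {r : List Bool} {h : ℕ}
    {l : List CounterDigit} (hs : h < s) :
    Emits moves x s ⟨.label side part, encList encBool bs ++ r, h, l⟩ ⟨.peek side part, r, h, l⟩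
      (encList encBool bs ++ (moves ++ [true])) := by
  induction bs with
  | nil => exact emits_read hs rfl
  | cons b bs ih =>
    exact Emits.trans (y := [true]) (emits_read hs rfl)
      (Emits.trans (y := encBool b) (emits_read hs rfl) ih)

theorem emits_inc (l m : List CounterDigit) {side : Polarity} {part : WordPart} {carry : Bool}
    {r : List Bool} (hs : (l ++ incCounter part carry m).length + 1 < s) :
    Emits moves x s ⟨.inc side part carry, r, l.length + 1, l ++ m⟩
      ⟨.back side part, r, (l ++ incCounter part carry m).length, l ++ incCounter part carry m⟩
      (encList encBool (addCarry carry (m.map Prod.fst)) ++ [false]) := by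
  induction m generalizing l carry with
  | nil =>
    cases carry with
    | false =>
      simp only [incCounter, List.append_nil] at hs ⊢
      exact emits_blank_left hs rfl
    | true =>
      rw [List.append_nil]
      have hpush : Emits moves x s ⟨.inc side part true, r, l.length + 1, l⟩
          ⟨.inc side part false, r, (l ++ incCounter part true []).length + 1,
            l ++ incCounter part true []⟩ (true :: encBool true) :=
        emits_stay (by simp [incCounter] at hs; omega)
          (by rw [counterTape_length_add_one]; rfl) (by simp [incCounter, Dir.move])
          (update_counterTape_push ..)
      exact hpush.trans (emits_blank_left hs rfl)
  | cons a m ih =>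
    have hshift : l ++ incCounter part carry (a :: m) =
        (l ++ [incDigit part carry a]) ++ incCounter part (a.1 && carry) m := by
      simp [incCounter]
    have hdigit : Emits moves x s ⟨.inc side part carry, r, l.length + 1, l ++ a :: m⟩
        ⟨.inc side part (a.1 && carry), r, (l ++ [incDigit part carry a]).length + 1,
          (l ++ [incDigit part carry a]) ++ m⟩ (true :: encBool (a.1 ^^ carry)) :=
      emits_digit_right (by simp [incCounter] at hs; omega) rfl
    rw [hshift] at hs ⊢
    have houtput : addCarry carry ((a :: m).map Prod.fst) =
        (a.1 ^^ carry) :: addCarry (a.1 && carry) (m.map Prod.fst) := by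
      simp only [List.map_cons, addCarry]
    rw [houtput]
    exact hdigit.trans (ih _ hs)

theorem emits_back (l m : List CounterDigit) {side : Polarity} {part : WordPart} {r : List Bool}
    (hs : l.length < s) :
    Emits moves x s ⟨.back side part, r, l.length, l ++ m⟩
      ⟨.word side part false, r, 1, l ++ m⟩ [] := by
  induction l using List.reverseRecOn generalizing m with
  | nil => exact emits_marker_right hs rfl
  | append_singleton l a ih =>
    simp only [List.length_append, List.length_singleton, List.append_assoc,
      List.singleton_append] at hs ⊢
    have hleft : Emits moves x s ⟨.back side part, r, l.length + 1, l ++ a :: m⟩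
        ⟨.back side part, r, l.length, l ++ a :: m⟩ [] :=
      emits_stay hs (by rw [counterTape_append_cons]; rfl) rfl (update_counterTape_replace ..)
    exact hleft.trans (ih (a :: m) (by omega))

theorem emits_flush (l m : List CounterDigit) {side : Polarity} {r : List Bool}
    (hs : (l ++ m).length + 1 < s) :
    Emits moves x s ⟨.flush side, r, l.length + 1, l ++ m⟩
      ⟨.clear side, r, (l ++ m).length, l ++ m⟩
      (encList encBool (m.filterMap Prod.snd) ++ [false, false]) := by
  induction m generalizing l with
  | nil =>
    rw [List.append_nil] at hs ⊢
    exact emits_blank_left hs rfl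
  | cons a m ih =>
    have hshift : l ++ a :: m = (l ++ [a]) ++ m := List.append_cons ..
    have houtput : encList encBool ((a :: m).filterMap Prod.snd) =
        (a.2.elim [] fun b => true :: encBool b) ++ encList encBool (m.filterMap Prod.snd) := by
      rcases a with ⟨b, _ | d⟩ <;> rfl
    rw [houtput, List.append_assoc]
    refine Emits.trans (emits_digit_right (by simp at hs; omega) rfl) ?_
    rw [hshift] at hs ⊢
    exact ih _ hs

theorem emits_clear (l : List CounterDigit) {side : Polarity} {r : List Bool}
    (hs : l.length < s) :
    Emits moves x s ⟨.clear side, r, l.length, l⟩ ⟨.list side, r, 1, []⟩ [] := by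
  induction l using List.reverseRecOn with
  | nil => exact emits_marker_right hs rfl
  | append_singleton l a ih =>
    rw [List.length_append, List.length_singleton] at hs ⊢
    have hpop : Emits moves x s ⟨.clear side, r, l.length + 1, l ++ [a]⟩
        ⟨.clear side, r, l.length, l⟩ [] :=
      emits_stay hs (by rw [counterTape_append_cons]; rfl) rfl (update_counterTape_pop l a)
    exact hpop.trans (ih (by omega))

theorem emits_letter {p : ℕ} (a : Finset (Fin p)) {n : ℕ} {side : Polarity} {part : WordPart}
    {first : Bool} {r : List Bool} {l : List CounterDigit}
    (hr : part = .loop → inputAt r 1 = .bit true) (hl : l.map Prod.fst = n.bits)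
    (hs : (n + 1).size + 1 < s) :
    Emits moves x s ⟨.word side part first, true :: (encLabel a ++ r), 1, l⟩
      ⟨.word side part false, r, 1, incCounter part true l⟩
      (true :: lassoRow moves first a (n + 1)) := by
  have hone : 1 < s := by omega
  have hlength : (incCounter part true l).length = (n + 1).size := by
    rw [← List.length_map Prod.fst, map_fst_incCounter, hl, addCarry_true_bits,
      Nat.size_eq_bits_len]
  have hpeek : Emits moves x s ⟨.peek side part, r, 1, l⟩ ⟨.inc side part true, r, 1, l⟩ [] := by
    refine emits_stay (c := counterTape l 1) (d := .stay) hone ?_ rfl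
      (Function.update_eq_self ..)
    cases part with
    | stem => rfl
    | loop => rw [hr rfl]; rfl
  have hinc := emits_inc (moves := moves) (x := x) (s := s) [] l (side := side) (part := part)
    (carry := true) (r := r) (by rwa [List.nil_append, hlength])
  have hback := emits_back (moves := moves) (x := x) (s := s) (incCounter part true l) []
    (side := side) (part := part) (r := r) (by omega)
  simp only [List.append_nil, List.nil_append] at hinc hback
  have hread : Emits moves x s ⟨.word side part first, true :: (encLabel a ++ r), 1, l⟩
      ⟨.label side part, encLabel a ++ r, 1, l⟩ (true :: encBool first) :=
    emits_read hone rfl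
  convert hread.trans ((emits_label _ hone).trans (hpeek.trans (hinc.trans hback))) using 1
  simp [lassoRow, encList, encBinary, encLabel, hl, addCarry_true_bits]

theorem emits_letters {p : ℕ} (as : List (Finset (Fin p))) {n : ℕ} {side : Polarity}
    {part : WordPart} {r : List Bool} {l : List CounterDigit}
    (hr : part = .loop → inputAt r 1 = .bit true) (hl : l.map Prod.fst = n.bits)
    (hs : (n + as.length).size + 1 < s) :
    Emits moves x s
      ⟨.word side part (n == 0), (as.flatMap fun a => true :: encLabel a) ++ r, 1, l⟩
      ⟨.word side part (n + as.length == 0), r, 1, (incCounter part true)^[as.length] l⟩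
      ((chainRows moves n as).flatMap fun row => true :: row) := by
  induction as generalizing n l with
  | nil => exact Emits.refl _
  | cons a as ih =>
    have hr' : part = .loop →
        inputAt ((as.flatMap fun a => true :: encLabel a) ++ r) 1 = .bit true := by
      cases as with
      | nil => exact hr
      | cons => exact fun _ => rfl
    have hsize : (n + 1).size ≤ (n + (a :: as).length).size :=
      Nat.size_le_size (by simp)
    have hl' : (incCounter part true l).map Prod.fst = (n + 1).bits := by
      rw [map_fst_incCounter, hl, addCarry_true_bits]
    have hlength : n + (a :: as).length = n + 1 + as.length := by
      rw [List.length_cons]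
      omega
    have hletter := emits_letter (moves := moves) (x := x) (s := s) (side := side)
      (first := n == 0) a hr' hl ((Nat.add_le_add_right hsize 1).trans_lt hs)
    rw [hlength] at hs ⊢
    simpa [chainRows] using hletter.trans (ih hl' hs)

theorem emits_last_letter {p : ℕ} (a : Finset (Fin p)) {m : ℕ} {side : Polarity} {first : Bool}
    {r : List Bool} {l : List CounterDigit} (hl : l.filterMap Prod.snd = m.bits)
    (hs : l.length + 1 < s) :
    Emits moves x s ⟨.word side .loop first, true :: (encLabel a ++ false :: r), 1, l⟩
      ⟨.list side, r, 1, []⟩ (true :: (lassoRow moves first a m ++ [false])) := by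
  have hone : 1 < s := by omega
  have hread : Emits moves x s
      ⟨.word side .loop first, true :: (encLabel a ++ false :: r), 1, l⟩
      ⟨.label side .loop, encLabel a ++ false :: r, 1, l⟩ (true :: encBool first) :=
    emits_read hone rfl
  have hpeek : Emits moves x s ⟨.peek side .loop, false :: r, 1, l⟩ ⟨.flush side, r, 1, l⟩ [] :=
    emits_read hone rfl
  have hflush := emits_flush (moves := moves) (x := x) (s := s) [] l (side := side) (r := r) hs
  simp only [List.nil_append] at hflush
  convert hread.trans ((emits_label _ hone).trans
    (hpeek.trans (hflush.trans (emits_clear l (by omega))))) using 1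
  simp [lassoRow, encList, encBinary, encLabel, hl]

theorem emits_word {p : ℕ} (w : UPWord p) {side : Polarity} {r : List Bool}
    (hs : (w.u.length + w.v.length).size + 1 < s) :
    Emits moves x s ⟨.word side .stem true, w.enc ++ r, 1, []⟩ ⟨.list side, r, 1, []⟩
      (encList id (lassoRows moves w)) := by
  set stemCounter := (incCounter .stem true)^[w.u.length] [] with hstemCounter
  set loopCounter := (incCounter .loop true)^[w.v.dropLast.length] stemCounter with hloopCounter
  have hfst : stemCounter.map Prod.fst = w.u.length.bits := by
    rw [hstemCounter, map_fst_iterate_incCounter (n := 0) .stem rfl, Nat.zero_add]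
  have hsnd : loopCounter.filterMap Prod.snd = w.u.length.bits := by
    rw [hloopCounter, filterMap_snd_iterate_incCounter_loop,
      filterMap_snd_iterate_incCounter_stem]
  have hsize : ∀ i ≤ w.u.length + w.v.length, i.size + 1 < s := fun i hi =>
    (Nat.add_le_add_right (Nat.size_le_size hi) 1).trans_lt hs
  have hlength : loopCounter.length = (w.u.length + w.v.dropLast.length).size := by
    rw [← Nat.size_eq_bits_len, ← map_fst_iterate_incCounter .loop hfst, List.length_map]
  have hlengthLe : w.u.length + w.v.dropLast.length ≤ w.u.length + w.v.length :=
    Nat.add_le_add_left (List.dropLast_sublist _).length_le _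
  have hstem := emits_letters (moves := moves) (x := x) (side := side) (part := .stem) (n := 0)
    (l := []) (s := s) (r := false :: ((w.v.dropLast.flatMap fun a => true :: encLabel a) ++
      true :: (encLabel (w.v.getLast w.v_ne_nil) ++ false :: r))) w.u (by simp) rfl
    (hsize _ (by omega))
  have hloop := emits_letters (moves := moves) (x := x) (side := side) (part := .loop)
    w.v.dropLast
    (r := true :: (encLabel (w.v.getLast w.v_ne_nil) ++ false :: r)) (fun _ => rfl) hfst
    (hsize _ hlengthLe)
  rw [Nat.zero_add] at hstem
  rw [w.enc_append, encList_lassoRows]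
  exact hstem.trans (Emits.trans (y := []) (emits_read (hsize 0 (Nat.zero_le _)) rfl)
    (hloop.trans (emits_last_letter _ hsnd (hlength ▸ hsize _ hlengthLe))))

theorem emits_words {p : ℕ} (ws : List (UPWord p)) {side : Polarity} {r : List Bool}
    (hone : 1 < s) (hs : ∀ w ∈ ws, (w.u.length + w.v.length).size + 1 < s) :
    Emits moves x s ⟨.list side, encList UPWord.enc ws ++ r, 1, []⟩ ⟨.afterList side, r, 1, []⟩
      (encList (fun w => encList id (lassoRows moves w)) ws) := by
  induction ws with
  | nil => exact emits_read hone rfl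
  | cons w ws ih =>
    rw [List.forall_mem_cons] at hs
    have hword := emits_word (moves := moves) (x := x) (side := side)
      (r := encList UPWord.enc ws ++ r) w hs.1
    rw [← List.append_assoc] at hword
    exact Emits.trans (y := [true]) (emits_read hone rfl) (hword.trans (ih hs.2))

theorem emits_copy (r : List Bool) {h : ℕ} {l : List CounterDigit} (hs : h < s) :
    Emits moves x s ⟨.copy, r, h, l⟩ ⟨.copy, [], h, l⟩ r := by
  induction r with
  | nil => exact Emits.refl _
  | cons b r ih => exact Emits.trans (y := [b]) (emits_read hs rfl) ih

theorem runsInSpace_start (hs : 0 < s) :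
    (lassoMachine moves).RunsInSpace x s (lassoMachine moves).initial
      (Snapshot.config moves x ⟨.unary, x, 1, []⟩ []) := by
  have htape : Function.update (fun _ => Cell.blank) 0 Cell.marker = counterTape [] := by
    funext i
    cases i <;> simp [counterTape]
  refine Relation.ReflTransGen.single ⟨?_, fun _ => hs⟩
  simp [Transducer.next, Transducer.initial, lassoMachine, lassoStep, Snapshot.config, Dir.move,
    htape]

theorem next_config_copy_nil (l : List CounterDigit) (o : List Bool) :
    (lassoMachine moves).next x (Snapshot.config moves x ⟨.copy, [], 1, l⟩ o) = none := by
  have hinput : inputAt x (x.length + 1) = .rightEnd := inputAt_of_isSuffix List.nil_suffix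
  simp only [Transducer.next, Snapshot.config, lassoMachine, List.length_nil, Nat.sub_zero,
    hinput]
  rfl

end Emits

theorem UPWord.length_add_length_le_length_enc {p : ℕ} (w : UPWord p) :
    w.u.length + w.v.length ≤ w.enc.length := by
  rw [enc, List.length_append]
  exact Nat.add_le_add (length_le_length_encList _ _) (length_le_length_encList _ _)

theorem UPWord.length_add_length_le_of_mem (I : LearnInst UPWord) {w : UPWord I.numProp}
    (hw : w ∈ I.pos ∨ w ∈ I.neg) :
    w.u.length + w.v.length ≤ (I.enc fun _ => UPWord.enc).length := by
  have hword := w.length_add_length_le_length_enc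
  simp only [LearnInst.enc, List.length_append]
  rcases hw with hw | hw
  · have := length_le_length_encList_of_mem UPWord.enc hw
    omega
  · have := length_le_length_encList_of_mem UPWord.enc hw
    omega

theorem lassoMachine_computesInSpace {Model : ℕ → Type} {e : ∀ p, Model p → List Bool}
    {g : ∀ p, UPWord p → Model p} {moves : List Bool}
    (hg : ∀ p w, e p (g p w) = encList id (lassoRows moves w)) (I : LearnInst UPWord) :
    (lassoMachine moves).ComputesInSpace (I.enc fun _ => UPWord.enc) ((I.map g).enc e)
      (3 * (Nat.log 2 (I.enc fun _ => UPWord.enc).length + 1)) := by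
  set x := I.enc fun _ => UPWord.enc
  set s := 3 * (Nat.log 2 x.length + 1)
  have hone : 1 < s := by
    change 1 < 3 * (Nat.log 2 x.length + 1)
    omega
  have hsize : ∀ w, w ∈ I.pos ∨ w ∈ I.neg → (w.u.length + w.v.length).size + 1 < s :=
    fun w hw => by
      have : (w.u.length + w.v.length).size ≤ Nat.log 2 x.length + 1 :=
        size_le_log_add_one (UPWord.length_add_length_le_of_mem I hw)
      change _ < 3 * (Nat.log 2 x.length + 1)
      omega
  have hrun : Emits moves x s ⟨.unary, x, 1, []⟩ ⟨.copy, [], 1, []⟩ ((I.map g).enc e) := by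
    simp only [LearnInst.enc, LearnInst.map, encList_map, hg]
    exact (emits_unary _ hone).trans ((emits_words (side := .pos) _ hone fun w hw =>
      hsize w (.inl hw)).trans ((emits_words (side := .neg) _ hone fun w hw =>
        hsize w (.inr hw)).trans (emits_copy _ hone)))
  exact ((runsInSpace_start (by omega)).trans ((hrun List.suffix_rfl).2 [])).computesInSpace
    (next_config_copy_nil _ _) fun _ => hone

theorem isLogspaceReduction_toLassos (Ut : Set UnOp) (Bt : Set TempBin) (Bl : Set LogBin)
    (n : ℕ∞) :
    IsLogspaceReduction (LTLLearn Ut Bt Bl n) (CTLLearn Ut Bt Bl n) LearnInst.toLassos :=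
  ⟨fun I => exists_separating_iff_of_sat_erase .all models_lasso_iff Ut Bt Bl n I.pos I.neg
    I.bound, lassoMachine [], 3, lassoMachine_computesInSpace fun _ => enc_lasso⟩

theorem isLogspaceReduction_map_gameLasso (k : ℕ) (Ut : Set UnOp) (Bt : Set TempBin)
    (Bl : Set LogBin) (n : ℕ∞) :
    IsLogspaceReduction (LTLLearn Ut Bt Bl n) (ATLLearn k Ut Bt Bl n)
      (LearnInst.map fun _ => gameLasso k) :=
  ⟨fun I => exists_separating_iff_of_sat_erase ∅ models_gameLasso_iff Ut Bt Bl n I.pos I.neg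
    I.bound, lassoMachine (encList encUnary (List.replicate k 1)), 3,
    lassoMachine_computesInSpace fun _ => enc_gameLasso k⟩

end LearnTL

theorem mainTheorem2 (Ut : Set LearnTL.UnOp) (Bt : Set LearnTL.TempBin)
    (Bl : Set LearnTL.LogBin) (n : ℕ∞) :
    LearnTL.IsLogspaceReduction (LearnTL.LTLLearn Ut Bt Bl n) (LearnTL.CTLLearn Ut Bt Bl n)
        LearnTL.LearnInst.toLassos ∧
      ∀ k : ℕ, 1 ≤ k →
        LearnTL.LogspaceReducible (LearnTL.LTLLearn Ut Bt Bl n)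
          (LearnTL.ATLLearn k Ut Bt Bl n) :=
  ⟨LearnTL.isLogspaceReduction_toLassos Ut Bt Bl n, fun k _ =>
    ⟨_, LearnTL.isLogspaceReduction_map_gameLasso k Ut Bt Bl n⟩⟩
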